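/- Let $\Bbbk$ be an arbitrary field. All algebras are $\Bbbk$-vector spaces with a bilinear product, and $(a,b,c)=(a\circ b)\circ c-a\circ(b\circ c)$ denotes the associator. An algebra $(A,\circ)$ is \emph{left-symmetric} if $(a,b,c)=(b,a,c)$ for all $a,b,c$. A left-symmetric algebra $A$ is an \emph{SLS-algebra} if \[ ((x\circ y)\circ z)\circ u=((x\circ z)\circ y)\circ u,\qquad (x,y\circ z,u)=(y,x\circ z,u) \] for all $x,y,z,u\in A$. Let $A\circ A$ be the linear span of all products $a\circ b$. An SLS-algebra $A$ is \emph{nice} if for every $x\in A$ there exists a linear map $\mu_x:A\circ A\to A$ such that $\mu_x(a\circ b)=(a\circ x)\circ b$ for all $a,b\in A$. A \emph{differential Perm-algebra} is an associative (not necessarily unital) algebra $P$ satisfying $abc=bac$, together with a derivation $d$, i.e. a linear map $d:P\to P$ with $d(ab)=d(a)b+a\,d(b)$. \textbf{Theorem.} Let $(A,\circ)$ be a left-symmetric algebra over $\Bbbk$. There exist a differential Perm-algebra $(P,d)$ over $\Bbbk$ and an injective linear map $\iota:A\to P$ with $\iota(a\circ b)=\iota(a)\,d(\iota(b))$ for all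 $a,b\in A$ if and only if $A$ is a nice SLS-algebra. Equivalently, such an embedding exists if and only if $A$ is an SLS-algebra that satisfies, for all $n\ge 0$ and all $a_i,b_i,x\in A$ $(i=1,\dots,n)$, the quasi-identity \[ \sum_{i=1}^n a_i\circ b_i=0\ \Longrightarrow\ \sum_{i=1}^n (a_i\circ x)\circ b_i=0 . \] -/

import Mathlib

universe u v w

/-- A left-symmetric algebra (Mathlib's `LeftPreLieRing`, with product `a ∘ b` written `a * b`)
is an SLS-algebra if it satisfies `((x ∘ y) ∘ z) ∘ t = ((x ∘ z) ∘ y) ∘ t` and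
`(x, y ∘ z, t) = (y, x ∘ z, t)`, where `(a, b, c)` is the associator. -/
structure IsSLS (A : Type u) [LeftPreLieRing A] : Prop where
  right_comm_mul : ∀ x y z t : A, ((x * y) * z) * t = ((x * z) * y) * t
  associator_mul : ∀ x y z t : A, associator x (y * z) t = associator y (x * z) t

/-- The subspace `A ∘ A` spanned by all products. -/
def mulSpan (K : Type v) (A : Type u) [Field K] [LeftPreLieRing A] [LeftPreLieAlgebra K A] :
    Submodule K A :=
  Submodule.span K (Set.range fun p : A × A => p.1 * p.2)

theorem mul_mem_mulSpan (K : Type v) {A : Type u} [Field K] [LeftPreLieRing A]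
    [LeftPreLieAlgebra K A] (a b : A) : a * b ∈ mulSpan K A :=
  Submodule.subset_span ⟨(a, b), rfl⟩

/-- An SLS-algebra is nice if for every `x` there is a linear map `μ : A ∘ A → A` such that
`μ (a ∘ b) = (a ∘ x) ∘ b` for all `a`, `b`. -/
structure IsNiceSLS (K : Type v) (A : Type u) [Field K] [LeftPreLieRing A]
    [LeftPreLieAlgebra K A] : Prop extends IsSLS A where
  nice : ∀ x : A, ∃ μ : mulSpan K A →ₗ[K] A,
    ∀ a b : A, μ ⟨a * b, mul_mem_mulSpan K a b⟩ = (a * x) * b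

/-- The quasi-identities of niceness: whenever `∑ aᵢ ∘ bᵢ = 0`, also `∑ (aᵢ ∘ x) ∘ bᵢ = 0`
for every `x`. -/
def SatisfiesNiceQuasiIdentities (A : Type u) [LeftPreLieRing A] : Prop :=
  ∀ (n : ℕ) (a b : Fin n → A), ∑ i, a i * b i = 0 → ∀ x : A, ∑ i, (a i * x) * b i = 0

/-- A (not necessarily unital) associative algebra is a Perm-algebra if `abc = bac`. -/
def IsPerm (P : Type u) [NonUnitalRing P] : Prop :=
  ∀ a b c : P, a * b * c = b * a * c

/-- A linear map `d` is a derivation of the (non-commutative, non-unital) algebra `P` if it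
satisfies the Leibniz rule. -/
def IsLeibniz {K : Type v} {P : Type u} [Field K] [NonUnitalRing P] [Module K P]
    (d : P →ₗ[K] P) : Prop :=
  ∀ a b : P, d (a * b) = d a * b + a * d b

/-- The left-symmetric algebra `A` embeds into a differential Perm-algebra `(P, d)` over `K` so
that `a ∘ b = a d(b)`. The universe of `P` is any one that is large enough for `K` and `A`. -/
def EmbedsInDifferentialPerm (K : Type v) (A : Type u) [Field K] [LeftPreLieRing A]
    [LeftPreLieAlgebra K A] : Prop :=
  ∃ (P : Type (max u v w)) (_ : NonUnitalRing P) (_ : Module K P) (_ : IsScalarTower K P P)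
    (_ : SMulCommClass K P P) (d : P →ₗ[K] P) (ι : A →ₗ[K] P),
    IsPerm P ∧ IsLeibniz d ∧ Function.Injective ι ∧ ∀ a b : A, ι (a * b) = ι a * d (ι b)

/-!
If `A` embeds into a differential Perm-algebra, then `(a, b, c) = -a b c''`, and left factors may be
permuted, which gives the SLS identities; multiplication by `x'` on the left maps `a b'` to
`a x' b'`, so `A` is nice.

For the converse it suffices to find a commutative differential algebra `C` and linear maps
`j, e : A → C` with `j (a ∘ b) = j a (j b)'`, `e (a ∘ b) = j a (e b)'` and `e` injective on
`A ∘ A`: then `C × C × A / (A ∘ A)` with the product `(x, y, q) (x', y', q') = (y x', y y', 0)` is a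
differential Perm-algebra, and `a ↦ (e a, j a, [a])` is the embedding. Such maps are found in two
steps.

*A Novikov algebra.* Left multiplications `L` and the maps `R x = μ_x` of niceness satisfy on
`A ∘ A` the identities of a Novikov bimodule (`IsNiceSLS.exists_bimodule`). An element `v` of `A`
outside `A ∘ A` can be multiplied by `L a` but not by `R x`. Its products with elements `T` of the
commutant of the `R x` are added freely, as tensors `T ⊗ v`, on which
`L a (T ⊗ v) = [L a, T] ⊗ v + T (a ∘ v)`; this is again a Novikov bimodule
(`IsNovikovBimodule.extension`), and it contains an image of `A`. The split extension of the
operators `(L a, R a)` by this bimodule is a Novikov algebra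
(`IsNovikovBimodule.exists_novikov`).

*Embedding a Novikov algebra `N`* into a commutative differential algebra
(`IsNovikov.exists_embedding`). The universal candidate is the quotient of the differential
polynomial ring on `N` by the differential ideal generated by the relations `a b' = a ∘ b`. The map
from `N` is injective because there is a linear map from differential polynomials to `N` that
vanishes on the ideal and sends each `x` to itself. It is built from the symmetric braces
`{z₁, …, zₙ | x}`, the elements of `N` that have to represent `z₁ ⋯ zₙ x⁽ⁿ⁾`: a monomial of weight
`-1` (where `x⁽ⁿ⁾` has weight `n - 1`) is a product of one undifferentiated letter and of factors
`z₁ ⋯ zₙ x⁽ⁿ⁺¹⁾`, which act on `N` by inserting into a brace. Braces are symmetric by left symmetry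
(`brace_perm`), the insertions commute by right commutativity (`brace_brace_comm`), and these two
facts together make the result independent of how the letters are distributed
(`evalMonomial_perm_and_exchange`). The ideal is killed by the Leibniz rule for braces
(`brace_mul`).
-/

/-! ### Symmetric braces of a left-symmetric algebra -/

section Brace

variable {K N W : Type*} [CommRing K] [AddCommGroup N] [Module K N] [AddCommGroup W]

/-- A bilinear product is a Novikov product if it is left-symmetric and right-commutative. -/
structure IsNovikov (m : N →ₗ[K] N →ₗ[K] N) : Prop where
  left_symm : ∀ a b c, m (m a b) c - m a (m b c) = m (m b a) c - m b (m a c)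
  right_comm : ∀ a b c, m (m a b) c = m (m a c) b

/-- The sum of the values of `F` at the lists obtained from a list by replacing one of its
entries `a` by `m z a`. -/
def slotSum (m : N →ₗ[K] N →ₗ[K] N) (z : N) : List N → (List N → W) → W
  | [], _ => 0
  | a :: α, F => F (m z a :: α) + slotSum m z α (fun β => F (a :: β))

/-- `F`, seen as a family of functions of `n` variables for every `n`, is multilinear. -/
def SlotLinear (K : Type*) [CommRing K] [Module K N] [Module K W] (F : List N → W) : Prop :=
  ∀ (α : List N) (c : K) (a b : N) (β : List N),
    F (α ++ (c • a + b) :: β) = c • F (α ++ a :: β) + F (α ++ b :: β)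

variable {m : N →ₗ[K] N →ₗ[K] N}

theorem slotSum_congr (z : N) : ∀ (α : List N) {F G : List N → W},
    (∀ β, β.length = α.length → F β = G β) → slotSum m z α F = slotSum m z α G
  | [], _, _, _ => rfl
  | a :: α, F, G, h => by
    simp only [slotSum]
    rw [h _ (by simp), slotSum_congr z α (fun β hβ => h (a :: β) (by simp [hβ]))]

theorem slotSum_add (z : N) : ∀ (α : List N) (F G : List N → W),
    slotSum m z α (fun β => F β + G β) = slotSum m z α F + slotSum m z α G
  | [], _, _ => by simp [slotSum]
  | a :: α, F, G => by
    simp only [slotSum]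
    rw [slotSum_add z α (fun β => F (a :: β)) (fun β => G (a :: β))]; abel

theorem slotSum_append (z : N) : ∀ (α β : List N) (F : List N → W),
    slotSum m z (α ++ β) F =
      slotSum m z α (fun γ => F (γ ++ β)) + slotSum m z β (fun γ => F (α ++ γ))
  | [], β, F => by simp [slotSum]
  | a :: α, β, F => by
    simp only [slotSum, List.cons_append]
    rw [slotSum_append z α β (fun γ => F (a :: γ))]; abel

theorem slotSum_perm (z : N) {α α' : List N} (hp : α.Perm α') : ∀ {F : List N → W},
    (∀ β β', β.length = α.length → β.Perm β' → F β = F β') →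
    slotSum m z α F = slotSum m z α' F := by
  induction hp with
  | nil => intro F _; rfl
  | @cons x l₁ l₂ hl ih =>
    intro F h
    simp only [slotSum]
    rw [h (m z x :: l₁) (m z x :: l₂) (by simp) (hl.cons _),
      ih (F := fun β => F (x :: β)) (fun β β' hβ hp => h _ _ (by simp [hβ]) (hp.cons x))]
  | swap x y l =>
    intro F h
    simp only [slotSum]
    rw [h (m z y :: x :: l) (x :: m z y :: l) (by simp) (List.Perm.swap _ _ _),
      h (y :: m z x :: l) (m z x :: y :: l) (by simp) (List.Perm.swap _ _ _),
      slotSum_congr z l (F := fun β => F (y :: x :: β)) (G := fun β => F (x :: y :: β))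
        (fun β hβ => h _ _ (by simp [hβ]) (List.Perm.swap _ _ _))]
    abel
  | @trans l₁ l₂ l₃ h₁ h₂ ih₁ ih₂ =>
    intro F h
    rw [ih₁ h, ih₂ (fun β β' hβ hp => h β β' (by rw [hβ, h₁.length_eq]) hp)]

variable [Module K W]

theorem SlotLinear.cons {F : List N → W} (h : SlotLinear K F) (a : N) :
    SlotLinear K (fun β => F (a :: β)) :=
  fun α c x y β => h (a :: α) c x y β

theorem SlotLinear.head {F : List N → W} (h : SlotLinear K F) (c : K) (a b : N) (β : List N) :
    F ((c • a + b) :: β) = c • F (a :: β) + F (b :: β) :=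
  h [] c a b β

theorem SlotLinear.head_sub {F : List N → W} (h : SlotLinear K F) (a b : N) (β : List N) :
    F ((a - b) :: β) = F (a :: β) - F (b :: β) := by
  have := h.head (-1) b a β
  rw [show (-1 : K) • b + a = a - b by rw [neg_one_smul]; abel] at this
  rw [this, neg_one_smul]; abel

theorem slotSum_map {W' : Type*} [AddCommGroup W'] [Module K W'] (f : W →ₗ[K] W') (z : N) :
    ∀ (α : List N) (F : List N → W),
    slotSum m z α (fun β => f (F β)) = f (slotSum m z α F)
  | [], _ => by simp [slotSum]
  | a :: α, F => by
    simp only [slotSum]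
    rw [slotSum_map f z α (fun β => F (a :: β)), map_add]

theorem slotSum_smul_add (z : N) (c : K) (α : List N) (F G : List N → W) :
    slotSum m z α (fun β => c • F β + G β) = c • slotSum m z α F + slotSum m z α G := by
  rw [slotSum_add z α (fun β => c • F β) G]
  congr 1
  exact slotSum_map (c • LinearMap.id : W →ₗ[K] W) z α F

theorem slotSum_sub (z : N) (α : List N) (F G : List N → W) :
    slotSum m z α (fun β => F β - G β) = slotSum m z α F - slotSum m z α G := by
  have := slotSum_smul_add (m := m) z (-1 : K) α G F
  simp only [neg_one_smul] at this
  rw [sub_eq_neg_add, ← this]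
  exact slotSum_congr z α fun β _ => by abel

theorem slotSum_smul_add_left (c : K) (y z : N) : ∀ (α : List N) {F : List N → W},
    SlotLinear K F → slotSum m (c • y + z) α F = c • slotSum m y α F + slotSum m z α F
  | [], _, _ => by simp [slotSum]
  | a :: α, F, h => by
    simp only [slotSum]
    rw [slotSum_smul_add_left c y z α (h.cons a), map_add, map_smul, LinearMap.add_apply,
      LinearMap.smul_apply, h.head, smul_add]
    abel

theorem SlotLinear.slotSum (z : N) {F : List N → W} (h : SlotLinear K F) :
    SlotLinear K (fun α => slotSum m z α F) := by
  intro α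
  induction α generalizing F with
  | nil =>
    intro c a b β
    simp only [List.nil_append, _root_.slotSum]
    rw [map_add, map_smul, h.head]
    simp only [h.head]
    rw [slotSum_smul_add]
    simp only [smul_add]; abel
  | cons x α ih =>
    intro c a b β
    simp only [List.cons_append, _root_.slotSum]
    have h1 := ih (h.cons x) c a b β
    simp only at h1
    rw [h1]
    have h2 := h (m z x :: α) c a b β
    simp only [List.cons_append] at h2
    rw [h2, smul_add]; abel

/-- The operators `slotSum m z` represent the commutator of `m`, up to sign: replacements in
different entries commute, and in the same entry left symmetry applies. -/
theorem slotSum_slotSum_sub (hm : IsNovikov m) (y z : N) : ∀ (α : List N) {F : List N → W},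
    SlotLinear K F →
    slotSum m y α (fun β => slotSum m z β F) - slotSum m z α (fun β => slotSum m y β F) =
      slotSum m (m z y - m y z) α F
  | [], _, _ => by simp [slotSum]
  | a :: α, F, h => by
    have ih := slotSum_slotSum_sub hm y z α (h.cons a)
    simp only [slotSum]
    rw [slotSum_add, slotSum_add, ← ih]
    have key : m (m z y - m y z) a = m z (m y a) - m y (m z a) := by
      rw [map_sub, LinearMap.sub_apply]
      have := hm.left_symm z y a
      rw [sub_eq_sub_iff_add_eq_add] at this ⊢
      rw [this]; abel
    rw [key, h.head_sub]
    abel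

/-- If `F` stands for the functions `z₁, …, zₙ ↦ z₁ ⋯ zₙ p` attached to an element `p` of a
differential algebra, this is the family of functions attached to the derivative of `p`. -/
def covDeriv (m : N →ₗ[K] N →ₗ[K] N) (F : List N → N) : List N → N
  | [] => 0
  | z :: α => m z (F α) - slotSum m z α F

/-- The function with value `x` at the empty list and `0` elsewhere. -/
def nilFn (x : N) : List N → N
  | [] => x
  | _ :: _ => 0

/-- The symmetric brace `{z₁, …, zₙ | x}`: the element that is `z₁ ⋯ zₙ x⁽ⁿ⁾` when `m a b = a b'`
in a commutative differential algebra. -/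
def brace (m : N →ₗ[K] N →ₗ[K] N) (α : List N) (x : N) : N :=
  (covDeriv m)^[α.length] (nilFn x) α

@[simp] theorem brace_nil (x : N) : brace m [] x = x := rfl

theorem brace_cons (z : N) (α : List N) (x : N) :
    brace m (z :: α) x = m z (brace m α x) - slotSum m z α (fun β => brace m β x) := by
  have : brace m (z :: α) x = covDeriv m ((covDeriv m)^[α.length] (nilFn x)) (z :: α) := by
    rw [← Function.iterate_succ_apply' (f := covDeriv m)]; rfl
  rw [this]
  simp only [covDeriv, brace]
  congr 1
  exact slotSum_congr z α fun β hβ => by rw [hβ]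

@[simp] theorem brace_singleton (z x : N) : brace m [z] x = m z x := by
  simp [brace_cons, slotSum]

theorem SlotLinear.covDeriv {F : List N → N} (h : SlotLinear K F) :
    SlotLinear K (covDeriv m F) := by
  intro α c a b β
  cases α with
  | nil =>
    simp only [List.nil_append, _root_.covDeriv]
    rw [slotSum_smul_add_left c a b β h, map_add, map_smul, LinearMap.add_apply,
      LinearMap.smul_apply, smul_sub]; abel
  | cons z α =>
    simp only [List.cons_append, _root_.covDeriv]
    have := h.slotSum (m := m) z α c a b β
    simp only at this
    rw [this, h α c a b β, map_add, map_smul, smul_sub]; abel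

theorem slotLinear_nilFn (x : N) : SlotLinear K (nilFn x) := by
  intro α c a b β
  cases α <;> simp [nilFn]

theorem slotLinear_brace (x : N) : SlotLinear K (fun α => brace m α x) := by
  have key : ∀ n, SlotLinear K ((covDeriv m)^[n] (nilFn x)) := by
    intro n
    induction n with
    | zero => exact slotLinear_nilFn x
    | succ n ih => rw [Function.iterate_succ_apply']; exact ih.covDeriv
  intro α c a b β
  have := key (α.length + (β.length + 1)) α c a b β
  simpa [brace] using this

theorem brace_smul_add_right (c : K) (x y : N) : ∀ α : List N,
    brace m α (c • x + y) = c • brace m α x + brace m α y := by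
  intro α
  induction hn : α.length generalizing α with
  | zero => obtain rfl := List.length_eq_zero_iff.1 hn; simp
  | succ n ih =>
    cases α with
    | nil => simp
    | cons z α =>
      simp only [List.length_cons, Nat.add_right_cancel_iff] at hn
      rw [brace_cons, brace_cons, brace_cons, ih α hn,
        slotSum_congr z α (fun β hβ => ih β (by omega)), slotSum_smul_add, map_add, map_smul,
        smul_sub]
      abel

/-- Braces are symmetric in the first two entries. The defect of symmetry is the recursion for
`{m z y - m y z, α | x}`, because `slotSum` and left multiplication both represent commutators. -/
theorem brace_swap (hm : IsNovikov m) (y z : N) (α : List N) (x : N) :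
    brace m (y :: z :: α) x = brace m (z :: y :: α) x := by
  have h := slotLinear_brace (m := m) x
  have e : ∀ y z : N, brace m (y :: z :: α) x =
      m y (m z (brace m α x)) - m y (slotSum m z α (fun β => brace m β x))
      - brace m (m y z :: α) x - slotSum m y α (fun β => m z (brace m β x))
      + slotSum m y α (fun β => slotSum m z β (fun γ => brace m γ x)) := by
    intro y z
    rw [brace_cons y, brace_cons z, map_sub]
    simp only [slotSum]
    rw [slotSum_congr y α (fun β _ => brace_cons z β x), slotSum_sub]
    abel
  have e3 := slotSum_slotSum_sub hm y z α h
  have e4 := slotSum_map (m := m) (m z) y α (fun β => brace m β x)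
  have e5 := slotSum_map (m := m) (m y) z α (fun β => brace m β x)
  have e6 := brace_cons (m := m) (m z y - m y z) α x
  rw [h.head_sub, map_sub, LinearMap.sub_apply] at e6
  have e7 := hm.left_symm y z (brace m α x)
  rw [e y z, e z y, e4, e5]
  rw [← sub_eq_zero] at e3 e6 e7 ⊢
  have : ∀ p q r s : N, q = 0 → r = 0 → s = 0 → p = q + r - s → p = 0 := by
    rintro p q r s rfl rfl rfl rfl; simp
  refine this _ _ _ _ e3 e6 e7 ?_
  abel

theorem brace_perm (hm : IsNovikov m) (x : N) {α β : List N} (h : α.Perm β) :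
    brace m α x = brace m β x := by
  induction hn : α.length generalizing α β with
  | zero =>
    obtain rfl := List.length_eq_zero_iff.1 hn
    rw [List.nil_perm.1 h]
  | succ n ih =>
    have hcons : ∀ (z : N) (l l' : List N), l.length = n → l.Perm l' →
        brace m (z :: l) x = brace m (z :: l') x := by
      intro z l l' hl hp
      rw [brace_cons, brace_cons, ih hp hl,
        slotSum_perm z hp (fun β β' hβ hp' => ih hp' (by omega))]
    clear ih
    induction h with
    | nil => rfl
    | cons z hl _ => exact hcons _ _ _ (by simpa using hn) hl
    | swap y z l => exact brace_swap hm _ _ _ _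
    | trans h₁ h₂ ih₁ ih₂ => rw [ih₁ hn, ih₂ (by rw [← h₁.length_eq, hn])]

end Brace

/-! ### Evaluation of monomials of weight minus one -/

section Evaluation

variable {K N : Type*} [CommRing K] [AddCommGroup N] [Module K N] {m : N →ₗ[K] N →ₗ[K] N}

theorem brace_insert_cons (hm : IsNovikov m) (c z : N) (α : List N) (x : N) :
    brace m (c :: z :: α) x = m z (brace m (c :: α) x) - brace m (m z c :: α) x
      - slotSum m z α (fun γ => brace m (c :: γ) x) := by
  rw [brace_swap hm, brace_cons, slotSum]
  abel

/-- The operator `c ↦ {c, α | x}`, which is multiplication by `α x⁽ⁿ⁺¹⁾`, `n = α.length`, when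
`m a b = a b'` in a commutative differential algebra. -/
def braceHead (m : N →ₗ[K] N →ₗ[K] N) (α : List N) (x : N) : N →ₗ[K] N where
  toFun c := brace m (c :: α) x
  map_add' a b := by
    have := (slotLinear_brace (m := m) x).head (1 : K) a b α
    simpa using this
  map_smul' c a := by
    have h0 := (slotLinear_brace (m := m) x).head (1 : K) 0 0 α
    have := (slotLinear_brace (m := m) x).head c a 0 α
    simp only [smul_zero, add_zero, one_smul, left_eq_add] at h0 this
    simpa [h0] using this

theorem braceHead_apply (α : List N) (x c : N) : braceHead m α x c = brace m (c :: α) x := rfl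

/-- The case of `brace_brace_comm` in which one of the multiplications is by `x'`. -/
theorem mul_brace_comm (hm : IsNovikov m) (x y : N) (β : List N) (c : N) :
    m (brace m (c :: β) y) x = brace m (m c x :: β) y := by
  induction hn : β.length generalizing β x c with
  | zero =>
    obtain rfl := List.length_eq_zero_iff.1 hn
    simpa using hm.right_comm c y x
  | succ n ih =>
    cases β with
    | nil => simp at hn
    | cons z β =>
      simp only [List.length_cons, Nat.add_right_cancel_iff] at hn
      rw [brace_insert_cons hm, brace_insert_cons hm]
      -- `[z d, x'] = (m z x)' - z' x'` as operators
      have key : ∀ c, m (m z c) x = m z (m c x) - m c (m z x) + m (m c z) x := by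
        intro c
        have := hm.left_symm z c x
        rw [sub_eq_sub_iff_add_eq_add] at this
        rw [sub_add_eq_add_sub, eq_sub_iff_add_eq, this]; abel
      simp only [map_sub, LinearMap.sub_apply]
      rw [ih x β _ hn, key (brace m (c :: β) y), ih x β c hn, ih (m z x) β c hn, ih z β c hn,
        ih x β _ hn]
      have h2 : m (slotSum m z β fun γ => brace m (c :: γ) y) x =
          slotSum m z β (fun γ => brace m (m c x :: γ) y) := by
        rw [← slotSum_congr z β (fun γ hγ => ih x γ c (hγ.trans hn))]
        exact (slotSum_map (m.flip x) z β _).symm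
      rw [h2]
      have h3 : brace m (m z (m c x) :: β) y =
          brace m (m (m z c) x :: β) y + brace m (m c (m z x) :: β) y
            - brace m (m (m c z) x :: β) y := by
        have := key c
        have h := congrArg (braceHead m β y) this
        simp only [map_sub, map_add] at h
        change brace m _ y = brace m _ y - brace m _ y + brace m _ y at h
        rw [h]; abel
      rw [h3]; abel

/-- Multiplications by elements of weight zero commute. -/
theorem brace_brace_comm (hm : IsNovikov m) (x y : N) (α β : List N) (c : N) :
    brace m (brace m (c :: β) y :: α) x = brace m (brace m (c :: α) x :: β) y := by
  induction hn : α.length generalizing α β c with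
  | zero =>
    obtain rfl := List.length_eq_zero_iff.1 hn
    simpa using mul_brace_comm hm x y β c
  | succ n ih =>
    cases α with
    | nil => simp at hn
    | cons z α =>
      simp only [List.length_cons, Nat.add_right_cancel_iff] at hn
      have e1 : ∀ c, m z (brace m (c :: β) y) = brace m (c :: z :: β) y + brace m (m z c :: β) y
          + slotSum m z β (fun γ => brace m (c :: γ) y) := by
        intro c; rw [brace_insert_cons hm]; abel
      have e2 : brace m (m z (brace m (c :: β) y) :: α) x =
          brace m (brace m (c :: α) x :: z :: β) y + brace m (brace m (m z c :: α) x :: β) y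
          + slotSum m z β (fun γ => brace m (brace m (c :: α) x :: γ) y) := by
        have h := congrArg (braceHead m α x) (e1 c)
        rw [map_add, map_add, ← slotSum_map] at h
        simp only [braceHead_apply] at h
        rw [h, ih α _ _ hn, ih α _ _ hn, slotSum_congr z β fun γ _ => ih α γ c hn]
      have e3 : brace m (brace m (c :: z :: α) x :: β) y =
          brace m (m z (brace m (c :: α) x) :: β) y - brace m (brace m (m z c :: α) x :: β) y
          - slotSum m z α (fun γ => brace m (brace m (c :: γ) x :: β) y) := by
        have h := congrArg (braceHead m β y) (brace_insert_cons hm c z α x)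
        rwa [map_sub, map_sub, ← slotSum_map] at h
      rw [brace_insert_cons hm, e2, e3, ih α β c hn, e1 (brace m (c :: α) x),
        slotSum_congr z α fun γ hγ => ih γ β c (hγ.trans hn)]
      abel

/-- The value of the monomial `z z₁ ⋯ zₖ x₁⁽ⁿ¹⁺¹⁾ ⋯ xᵣ⁽ⁿʳ⁺¹⁾` of weight `-1` (so that
`k = n₁ + ⋯ + nᵣ`), where each `xᵢ⁽ⁿ⁺¹⁾` consumes the next `n` of the `zⱼ`. It is `0` on
monomials of other weights. -/
def evalMonomial (m : N →ₗ[K] N →ₗ[K] N) : N → List N → List (N × ℕ) → N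
  | z, [], [] => z
  | _, _ :: _, [] => 0
  | z, Z, (x, n) :: X =>
    if n ≤ Z.length then evalMonomial m (brace m (z :: Z.take n) x) (Z.drop n) X else 0

theorem evalMonomial_cons (z : N) (Z : List N) (x : N) (n : ℕ) (X : List (N × ℕ)) :
    evalMonomial m z Z ((x, n) :: X) =
      if n ≤ Z.length then evalMonomial m (brace m (z :: Z.take n) x) (Z.drop n) X else 0 := by
  cases Z <;> rfl

theorem evalMonomial_append (z : N) (Z Z' : List N) (x : N) (X : List (N × ℕ)) :
    evalMonomial m z (Z ++ Z') ((x, Z.length) :: X) =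
      evalMonomial m (brace m (z :: Z) x) Z' X := by
  simp [evalMonomial_cons]

/-- A function on lists that is invariant under swaps of adjacent entries is invariant under all
permutations. -/
theorem List.Perm.congr_of_adjacent_swap {α β : Type*} {f : List α → β}
    (h : ∀ (l : List α) (a b : α) (r : List α), f (l ++ a :: b :: r) = f (l ++ b :: a :: r))
    {l₁ l₂ : List α} (hp : l₁.Perm l₂) : f l₁ = f l₂ := by
  suffices ∀ l, f (l ++ l₁) = f (l ++ l₂) from this []
  induction hp with
  | nil => intro l; rfl
  | cons x _ ih => intro l; simpa using ih (l ++ [x])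
  | swap x y l' => intro l; exact h _ _ _ _
  | trans _ _ ih₁ ih₂ => intro l; rw [ih₁, ih₂]

/-- Two symmetries of `evalMonomial`, which need each other: the undifferentiated letters may be
permuted, and letters may be exchanged across a brace. -/
theorem evalMonomial_perm_and_exchange (hm : IsNovikov m) (X : List (N × ℕ)) :
    (∀ (z w : N) (Z Z' : List N), (z :: Z).Perm (w :: Z') →
      evalMonomial m z Z X = evalMonomial m w Z' X) ∧
    (∀ (α : List N) (u w x : N) (β : List N),
      evalMonomial m (brace m (u :: α) x) (w :: β) X =
        evalMonomial m (brace m (w :: α) x) (u :: β) X) := by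
  induction X with
  | nil =>
    refine ⟨fun z w Z Z' h => ?_, fun _ _ _ _ _ => rfl⟩
    cases Z with
    | nil => obtain ⟨rfl, rfl⟩ : w = z ∧ Z' = [] := by simpa using h.symm
             rfl
    | cons a Z => cases Z' with
      | nil => simp at h
      | cons b Z' => rfl
  | cons p X ih =>
    obtain ⟨y, n⟩ := p
    obtain ⟨ihS, ihE⟩ := ih
    have hS : ∀ (z w : N) (Z Z' : List N), (z :: Z).Perm (w :: Z') →
        evalMonomial m z Z ((y, n) :: X) = evalMonomial m w Z' ((y, n) :: X) := by
      intro z w Z Z' h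
      have hlen : Z.length = Z'.length := by simpa using h.length_eq
      rw [evalMonomial_cons, evalMonomial_cons, hlen]
      split_ifs with hn
      swap; · rfl
      let f : List N → N := fun l =>
        evalMonomial m (brace m (l.take (n + 1)) y) (l.drop (n + 1)) X
      change f (z :: Z) = f (w :: Z')
      refine List.Perm.congr_of_adjacent_swap (fun l a b r => ?_) h
      simp only [f]
      rcases lt_trichotomy l.length n with hl | hl | hl
      · obtain ⟨k, rfl⟩ := Nat.exists_eq_add_of_lt hl
        have e : l.length + k + 1 + 1 = l.length + (k + 2) := by ring
        rw [e, List.take_length_add_append, List.take_length_add_append,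
          List.drop_length_add_append, List.drop_length_add_append]
        simp only [List.take_succ_cons, List.drop_succ_cons]
        rw [brace_perm hm y (List.Perm.append_left l (List.Perm.swap b a _))]
      · subst hl
        rw [List.take_length_add_append, List.take_length_add_append,
          List.drop_length_add_append, List.drop_length_add_append]
        simp only [List.take_succ_cons, List.drop_succ_cons, List.take_zero, List.drop_zero]
        rw [brace_perm hm y (List.perm_append_singleton a l),
          brace_perm hm y (List.perm_append_singleton b l), ihE]
      · have hl : n + 1 ≤ l.length := hl
        rw [List.take_append_of_le_length hl, List.take_append_of_le_length hl,
          List.drop_append_of_le_length hl, List.drop_append_of_le_length hl]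
        exact ihS _ _ _ _ ((List.Perm.append_left _ (List.Perm.swap b a _)).cons _)
    refine ⟨hS, fun α u w x β => ?_⟩
    rw [evalMonomial_cons, evalMonomial_cons]
    simp only [List.length_cons]
    split_ifs with hn
    swap; · rfl
    cases n with
    | zero =>
      simp only [List.take_zero, List.drop_zero]
      rw [brace_brace_comm hm, ihE, ihS _ _ _ _ (List.Perm.swap _ _ _), ihE]
    | succ k =>
      simp only [List.take_succ_cons, List.drop_succ_cons]
      rw [brace_brace_comm hm, brace_swap hm, brace_brace_comm hm]

theorem evalMonomial_perm (hm : IsNovikov m) (X : List (N × ℕ)) {z w : N} {Z Z' : List N}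
    (h : (z :: Z).Perm (w :: Z')) : evalMonomial m z Z X = evalMonomial m w Z' X :=
  (evalMonomial_perm_and_exchange hm X).1 z w Z Z' h

theorem evalMonomial_perm_right (hm : IsNovikov m) {X Y : List (N × ℕ)} (h : X.Perm Y) (z : N)
    (Z : List N) : evalMonomial m z Z X = evalMonomial m z Z Y := by
  induction h generalizing z Z with
  | nil => rfl
  | cons p _ ih =>
    obtain ⟨x, n⟩ := p
    simp only [evalMonomial_cons, ih]
  | trans _ _ ih₁ ih₂ => rw [ih₁, ih₂]
  | swap p q X =>
    obtain ⟨x, n⟩ := p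
    obtain ⟨y, k⟩ := q
    by_cases hn : k + n ≤ Z.length
    · obtain ⟨A, B, C, hA, hB, rfl⟩ : ∃ A B C : List N, A.length = k ∧ B.length = n ∧
          Z = A ++ (B ++ C) :=
        ⟨Z.take k, (Z.drop k).take n, (Z.drop k).drop n, by simp; omega, by simp; omega, by simp⟩
      subst hA hB
      -- the undifferentiated letters are permuted to keep the blocks together
      have h : (z :: (A ++ (B ++ C))).Perm (z :: (B ++ (A ++ C))) := by
        rw [← List.append_assoc, ← List.append_assoc]
        exact (List.perm_append_comm.append_right C).cons z
      rw [evalMonomial_append, evalMonomial_append, evalMonomial_perm hm _ h,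
        evalMonomial_append, evalMonomial_append, brace_brace_comm hm]
    · have : ∀ (a b : N) (i j : ℕ), i + j = k + n →
          evalMonomial m z Z ((a, i) :: (b, j) :: X) = 0 := by
        intro a b i j hij
        rw [evalMonomial_cons]
        split_ifs with h1
        · rw [evalMonomial_cons, if_neg (by simp; omega)]
        · rfl
      rw [this _ _ _ _ rfl, this _ _ _ _ (add_comm _ _)]

theorem evalMonomial_smul_add (c : K) (a b : N) (Z : List N) (X : List (N × ℕ)) :
    evalMonomial m (c • a + b) Z X = c • evalMonomial m a Z X + evalMonomial m b Z X := by
  induction X generalizing a b Z with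
  | nil => cases Z <;> simp [evalMonomial]
  | cons p X ih =>
    obtain ⟨x, n⟩ := p
    simp only [evalMonomial_cons]
    split_ifs
    · rw [← ih, (slotLinear_brace x).head]
    · simp

theorem evalMonomial_smul_add_right (c : K) (x y z : N) (n : ℕ) (Z : List N)
    (X : List (N × ℕ)) :
    evalMonomial m z Z ((c • x + y, n) :: X) =
      c • evalMonomial m z Z ((x, n) :: X) + evalMonomial m z Z ((y, n) :: X) := by
  simp only [evalMonomial_cons]
  split_ifs
  · rw [← evalMonomial_smul_add, brace_smul_add_right]
  · simp

/-- Letters may be exchanged between the inner and the outer brace, since both orders of insertion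
give the same result. -/
theorem brace_exchange (hm : IsNovikov m) (u w a b : N) (α β : List N) :
    brace m (brace m (u :: α) a :: w :: β) b = brace m (brace m (w :: α) a :: u :: β) b := by
  rw [brace_brace_comm hm, brace_swap hm, brace_brace_comm hm]

theorem slotSum_sum {ι : Type*} (s : Finset ι) (c : ι → ℕ) (z : N) (α : List N)
    (F : ι → List N → N) :
    slotSum m z α (fun β => ∑ i ∈ s, c i • F i β) = ∑ i ∈ s, c i • slotSum m z α (F i) := by
  classical
  induction s using Finset.induction_on with
  | empty => simpa using slotSum_map (m := m) (0 : N →ₗ[K] N) z α (fun _ => 0)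
  | insert i s hi ih =>
    simp only [Finset.sum_insert hi]
    rw [slotSum_add, ih]
    congr 1
    exact slotSum_map (m := m) (c i • (LinearMap.id : N →ₗ[K] N)) z α (F i)

/-- The inductive step of `brace_mul`: one more derivative falls either on `b` or on `a`. -/
theorem brace_mul_step (hm : IsNovikov m) (a b z : N) (α β : List N) :
    m z (brace m (brace m α a :: β) b) - slotSum m z (α ++ β)
        (fun γ => brace m (brace m (γ.take α.length) a :: γ.drop α.length) b) =
      brace m (brace m α a :: z :: β) b + brace m (brace m (z :: α) a :: β) b := by
  have h1 : slotSum m z α (fun γ => brace m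
      (brace m ((γ ++ β).take α.length) a :: (γ ++ β).drop α.length) b) =
      brace m (slotSum m z α (fun γ => brace m γ a) :: β) b := by
    rw [← braceHead_apply, ← slotSum_map]
    refine slotSum_congr z α fun γ hγ => ?_
    rw [← hγ, List.take_left, List.drop_left, braceHead_apply]
  rw [slotSum_append, h1]
  simp only [List.take_left, List.drop_left]
  rw [brace_insert_cons hm]
  have h2 : brace m (m z (brace m α a) :: β) b = brace m (brace m (z :: α) a :: β) b +
      brace m (slotSum m z α (fun γ => brace m γ a) :: β) b := by
    have h := congrArg (braceHead m β b) (brace_cons (m := m) z α a)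
    rw [map_sub] at h
    simp only [braceHead_apply] at h
    rw [h, sub_add_cancel]
  rw [h2]; abel

/-- The Leibniz rule for the higher derivatives of the product `m a b = a b'`. -/
theorem brace_mul (hm : IsNovikov m) (a b : N) (Z : List N) :
    brace m Z (m a b) = ∑ j ∈ Finset.range (Z.length + 1), Z.length.choose j •
        brace m (brace m (Z.take j) a :: Z.drop j) b := by
  induction hn : Z.length generalizing Z with
  | zero =>
    obtain rfl := List.length_eq_zero_iff.1 hn
    simp
  | succ n ih =>
    cases Z with
    | nil => simp at hn
    | cons z α =>
      simp only [List.length_cons, Nat.add_right_cancel_iff] at hn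
      have step : ∀ j ∈ Finset.range (n + 1),
          m z (brace m (brace m (α.take j) a :: α.drop j) b) - slotSum m z α
            (fun γ => brace m (brace m (γ.take j) a :: γ.drop j) b) =
          brace m (brace m ((z :: α).take j) a :: (z :: α).drop j) b +
            brace m (brace m ((z :: α).take (j + 1)) a :: (z :: α).drop (j + 1)) b := by
        intro j hj
        have hj : j ≤ α.length := by rw [hn]; exact Nat.lt_succ_iff.1 (Finset.mem_range.1 hj)
        have := brace_mul_step hm a b z (α.take j) (α.drop j)
        rw [List.take_append_drop, List.length_take, min_eq_left hj] at this
        rw [this]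
        congr 1
        cases j with
        | zero => simp
        | succ i =>
          have h1 : α.take (i + 1) = α.take i ++ [α[i]] := by simp
          have h2 : α.drop i = α[i] :: α.drop (i + 1) := by simp
          rw [List.take_succ_cons, List.drop_succ_cons, h2, h1,
            brace_perm hm a (List.perm_append_singleton _ _), brace_exchange hm]
      rw [brace_cons, slotSum_congr z α (fun β hβ => ih β (hβ.trans hn)), slotSum_sum,
        ih α hn, map_sum, ← Finset.sum_sub_distrib]
      simp only [map_nsmul, ← smul_sub]
      rw [Finset.sum_congr rfl fun j hj => by rw [step j hj]]
      simp only [smul_add]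
      rw [Finset.sum_add_distrib, Finset.sum_range_succ' _ (n + 1)]
      simp only [Nat.choose_succ_succ, add_smul, Finset.sum_add_distrib]
      rw [add_comm, add_assoc]
      congr 1
      rw [Finset.sum_range_succ', Finset.sum_range_succ _ n]
      simp

end Evaluation

/-! ### Embedding a Novikov algebra into a commutative differential algebra -/

section Embedding

open MvPolynomial

variable {K N : Type*} [CommRing K]

/-- The undifferentiated letters of a word in the letters `(a, n)`, which stand for `a⁽ⁿ⁾`. -/
def plainLetters (w : List (N × ℕ)) : List N :=
  w.filterMap fun p => if p.2 = 0 then some p.1 else none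

/-- The differentiated letters of a word; `(a, n)` in the result stands for `a⁽ⁿ⁺¹⁾`. -/
def derivedLetters (w : List (N × ℕ)) : List (N × ℕ) :=
  w.filterMap fun p => if p.2 = 0 then none else some (p.1, p.2 - 1)

@[simp] theorem plainLetters_zero (a : N) (w : List (N × ℕ)) :
    plainLetters ((a, 0) :: w) = a :: plainLetters w := by simp [plainLetters]

@[simp] theorem plainLetters_succ (a : N) (n : ℕ) (w : List (N × ℕ)) :
    plainLetters ((a, n + 1) :: w) = plainLetters w := by simp [plainLetters]

@[simp] theorem derivedLetters_zero (a : N) (w : List (N × ℕ)) :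
    derivedLetters ((a, 0) :: w) = derivedLetters w := by simp [derivedLetters]

@[simp] theorem derivedLetters_succ (a : N) (n : ℕ) (w : List (N × ℕ)) :
    derivedLetters ((a, n + 1) :: w) = (a, n) :: derivedLetters w := by simp [derivedLetters]

variable [AddCommGroup N] [Module K N] {m : N →ₗ[K] N →ₗ[K] N}

/-- The value of the monomial with undifferentiated letters `Z` and differentiated letters `X`. -/
def evalPlain (m : N →ₗ[K] N →ₗ[K] N) : List N → List (N × ℕ) → N
  | [], _ => 0
  | z :: Z, X => evalMonomial m z Z X

theorem evalPlain_perm (hm : IsNovikov m) {Z Z' : List N} {X X' : List (N × ℕ)}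
    (hZ : Z.Perm Z') (hX : X.Perm X') : evalPlain m Z X = evalPlain m Z' X' := by
  cases Z with
  | nil => rw [List.nil_perm.1 hZ]; rfl
  | cons z Z => cases Z' with
    | nil => simp at hZ
    | cons w Z' => exact (evalMonomial_perm hm X hZ).trans (evalMonomial_perm_right hm hX w Z')

/-- The value of a monomial of the differential polynomial ring on `N`. -/
def evalMultiset (hm : IsNovikov m) (s : Multiset (N × ℕ)) : N :=
  Quot.liftOn s (fun w => evalPlain m (plainLetters w) (derivedLetters w))
    fun _ _ h => evalPlain_perm hm (h.filterMap _) (h.filterMap _)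

theorem evalMultiset_smul_add (hm : IsNovikov m) (c : K) (a b : N) (n : ℕ)
    (s : Multiset (N × ℕ)) :
    evalMultiset hm ((c • a + b, n) ::ₘ s) =
      c • evalMultiset hm ((a, n) ::ₘ s) + evalMultiset hm ((b, n) ::ₘ s) := by
  induction s using Quot.inductionOn with | _ w
  change evalPlain m (plainLetters ((c • a + b, n) :: w)) (derivedLetters _) =
    c • evalPlain m (plainLetters ((a, n) :: w)) (derivedLetters ((a, n) :: w)) +
      evalPlain m (plainLetters ((b, n) :: w)) (derivedLetters ((b, n) :: w))
  cases n with
  | zero => simp [evalPlain, evalMonomial_smul_add]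
  | succ n =>
    simp only [plainLetters_succ, derivedLetters_succ]
    cases plainLetters w with
    | nil => simp [evalPlain]
    | cons z Z => exact evalMonomial_smul_add_right c a b z n Z _

/-- `evalMonomial` as a linear map in its first argument. -/
def evalMonomialHead (m : N →ₗ[K] N →ₗ[K] N) (Z : List N) (X : List (N × ℕ)) : N →ₗ[K] N where
  toFun z := evalMonomial m z Z X
  map_add' a b := by simpa using evalMonomial_smul_add (m := m) (1 : K) a b Z X
  map_smul' c a := by
    have h0 : evalMonomial m 0 Z X = 0 := by
      simpa using evalMonomial_smul_add (m := m) (1 : K) 0 0 Z X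
    simpa [h0] using evalMonomial_smul_add (m := m) c a 0 Z X

theorem evalMonomial_append_append (z a b : N) (A B C : List N) (X : List (N × ℕ)) {i k : ℕ}
    (hi : A.length = i) (hk : B.length = k) :
    evalMonomial m z (A ++ B ++ C) ((a, i) :: (b, k) :: X) =
      evalMonomial m (brace m (brace m (z :: A) a :: B) b) C X := by
  subst hi hk
  rw [List.append_assoc, evalMonomial_append, evalMonomial_append]

/-- `evalMultiset` respects the `k`-th derivative of the relation `m a b = a b'`. -/
theorem evalMultiset_mul (hm : IsNovikov m) (a b : N) (k : ℕ) (s : Multiset (N × ℕ)) :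
    evalMultiset hm ((m a b, k) ::ₘ s) = ∑ j ∈ Finset.range (k + 1),
      k.choose j • evalMultiset hm ((a, j) ::ₘ (b, k - j + 1) ::ₘ s) := by
  induction s using Quot.inductionOn with | _ w
  change evalPlain m (plainLetters ((m a b, k) :: w)) (derivedLetters ((m a b, k) :: w)) =
    ∑ j ∈ Finset.range (k + 1), k.choose j • evalPlain m
      (plainLetters ((a, j) :: (b, k - j + 1) :: w))
      (derivedLetters ((a, j) :: (b, k - j + 1) :: w))
  cases k with
  | zero => simp [evalPlain, evalMonomial_cons]
  | succ k =>
    rw [Finset.sum_range_succ']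
    simp only [plainLetters_succ, derivedLetters_succ, plainLetters_zero, derivedLetters_zero]
    cases plainLetters w with
    | nil => simp [evalPlain, evalMonomial_cons]
    | cons z Z =>
      simp only [evalPlain]
      by_cases hk : k ≤ Z.length
      · obtain ⟨A, C, rfl, rfl⟩ : ∃ A C : List N, A.length = k ∧ Z = A ++ C :=
          ⟨Z.take k, Z.drop k, by simp [hk], by simp⟩
        let f : N →ₗ[K] N := evalMonomialHead m C (derivedLetters w)
        rw [evalMonomial_append]
        change f _ = _
        rw [brace_mul hm, map_sum, List.length_cons, Finset.sum_range_succ']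
        simp only [map_nsmul]
        congr 1
        · refine Finset.sum_congr rfl fun j hj => ?_
          have hj : j ≤ A.length := Nat.lt_succ_iff.1 (Finset.mem_range.1 hj)
          have h := evalMonomial_append_append (m := m) z a b (A.take j) (A.drop j) C
            (derivedLetters w) (i := j) (k := A.length + 1 - (j + 1)) (by simp [hj]) (by simp)
          rw [List.take_append_drop] at h
          rw [h]
          rfl
        · exact congrArg _ (evalMonomial_append a (z :: A) C b _).symm
      · rw [evalMonomial_cons, if_neg hk, evalMonomial_cons, if_neg (by simp; omega)]
        rw [Finset.sum_eq_zero, smul_zero, add_zero]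
        intro j hj
        rw [evalMonomial_cons]
        split_ifs
        · rw [evalMonomial_cons, if_neg, smul_zero]
          simp at hj ⊢; omega
        · simp

/-- The evaluation of differential polynomials, zero on monomials of weight other than `-1`. -/
noncomputable def evalPoly (hm : IsNovikov m) : MvPolynomial (N × ℕ) K →ₗ[K] N :=
  (basisMonomials (N × ℕ) K).constr K fun s => evalMultiset hm (Finsupp.toMultiset s)

theorem evalPoly_monomial (hm : IsNovikov m) (s : (N × ℕ) →₀ ℕ) :
    evalPoly hm (monomial s (1 : K)) = evalMultiset hm (Finsupp.toMultiset s) := by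
  have := (basisMonomials (N × ℕ) K).constr_basis K
    (fun s => evalMultiset hm (Finsupp.toMultiset s)) s
  rwa [coe_basisMonomials] at this

theorem monomial_one_mul_X {σ : Type*} (s : σ →₀ ℕ) (p : σ) :
    monomial s (1 : K) * X p = monomial (Finsupp.single p 1 + s) 1 := by
  rw [X, monomial_mul, one_mul, add_comm]

theorem evalPoly_mul_X (hm : IsNovikov m) (s : (N × ℕ) →₀ ℕ) (p : N × ℕ) :
    evalPoly hm (monomial s (1 : K) * X p) = evalMultiset hm (p ::ₘ Finsupp.toMultiset s) := by
  rw [monomial_one_mul_X, evalPoly_monomial, map_add, Finsupp.toMultiset_single, one_nsmul,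
    Multiset.singleton_add]

theorem evalPoly_mul_X_mul_X (hm : IsNovikov m) (s : (N × ℕ) →₀ ℕ) (p q : N × ℕ) :
    evalPoly hm (monomial s (1 : K) * (X p * X q)) =
      evalMultiset hm (p ::ₘ q ::ₘ Finsupp.toMultiset s) := by
  rw [mul_comm (X p), ← mul_assoc, monomial_one_mul_X, evalPoly_mul_X, map_add,
    Finsupp.toMultiset_single, one_nsmul, Multiset.singleton_add]

theorem evalPoly_X (hm : IsNovikov m) (a : N) :
    evalPoly hm (X (a, 0) : MvPolynomial (N × ℕ) K) = a := by
  have := evalPoly_mul_X (K := K) hm 0 (a, 0)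
  rw [monomial_zero', map_one, one_mul] at this
  rw [this, map_zero]
  rfl

/-- The derivation of the differential polynomial ring on `N`. -/
noncomputable def polyDeriv (K N : Type*) [CommRing K] :
    Derivation K (MvPolynomial (N × ℕ) K) (MvPolynomial (N × ℕ) K) :=
  mkDerivation K fun p => X (p.1, p.2 + 1)

@[simp] theorem polyDeriv_X {N : Type*} (a : N) (n : ℕ) :
    polyDeriv K N (X (a, n)) = X (a, n + 1) :=
  mkDerivation_X _ _ _

/-- The `k`-th derivative of the relation `a b' - m a b`. -/
noncomputable def mulRel (m : N →ₗ[K] N →ₗ[K] N) (a b : N) (k : ℕ) : MvPolynomial (N × ℕ) K :=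
  ∑ p ∈ Finset.HasAntidiagonal.antidiagonal k, k.choose p.1 • (X (a, p.1) * X (b, p.2 + 1)) - X (m a b, k)

/-- The `k`-th derivative of the relation that makes the letters linear. -/
noncomputable def linRel (c : K) (a b : N) (k : ℕ) : MvPolynomial (N × ℕ) K :=
  c • X (a, k) + X (b, k) - X (c • a + b, k)

theorem polyDeriv_mulRel (a b : N) (k : ℕ) :
    polyDeriv K N (mulRel m a b k) = mulRel m a b (k + 1) := by
  rw [mulRel, mulRel, map_sub, map_sum, polyDeriv_X,
    Finset.sum_antidiagonal_choose_succ_nsmul (fun i j => X (a, i) * X (b, j + 1)),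
    ← Finset.sum_add_distrib]
  congr 1
  refine Finset.sum_congr rfl fun p hp => ?_
  rw [map_nsmul, Derivation.leibniz, polyDeriv_X, polyDeriv_X,
    ← Nat.choose_symm_of_eq_add (Finset.HasAntidiagonal.mem_antidiagonal.1 hp).symm, smul_add, smul_eq_mul,
    smul_eq_mul, mul_comm (X (b, _))]

theorem polyDeriv_linRel (c : K) (a b : N) (k : ℕ) :
    polyDeriv K N (linRel c a b k) = linRel c a b (k + 1) := by
  simp [linRel]

/-- The differential ideal of the relations `m a b = a b'` and of linearity of the letters. -/
noncomputable def relIdeal (m : N →ₗ[K] N →ₗ[K] N) : Ideal (MvPolynomial (N × ℕ) K) :=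
  Ideal.span ({p | ∃ a b k, p = mulRel m a b k} ∪ {p | ∃ c a b k, p = linRel c a b k})

theorem polyDeriv_mem_relIdeal {p : MvPolynomial (N × ℕ) K} (hp : p ∈ relIdeal m) :
    polyDeriv K N p ∈ relIdeal m := by
  induction hp using Submodule.span_induction with
  | mem x hx =>
    refine Ideal.subset_span ?_
    rcases hx with ⟨a, b, k, rfl⟩ | ⟨c, a, b, k, rfl⟩
    · exact Or.inl ⟨a, b, k + 1, polyDeriv_mulRel a b k⟩
    · exact Or.inr ⟨c, a, b, k + 1, polyDeriv_linRel c a b k⟩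
  | zero => simp
  | add x y _ _ hx hy => rw [map_add]; exact add_mem hx hy
  | smul q x hx hx' =>
    rw [smul_eq_mul, Derivation.leibniz]
    exact add_mem (Ideal.mul_mem_left _ _ hx') (Ideal.mul_mem_right _ _ hx)

theorem evalPoly_mul_mem_relIdeal (hm : IsNovikov m) (q : MvPolynomial (N × ℕ) K)
    {p : MvPolynomial (N × ℕ) K} (hp : p ∈ relIdeal m) : evalPoly hm (q * p) = 0 := by
  induction hp using Submodule.span_induction generalizing q with
  | mem x hx =>
    suffices h : evalPoly hm ∘ₗ LinearMap.mulRight K x = 0 from LinearMap.congr_fun h q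
    refine (basisMonomials (N × ℕ) K).ext fun s => ?_
    rw [coe_basisMonomials, LinearMap.comp_apply, LinearMap.mulRight_apply, LinearMap.zero_apply]
    rcases hx with ⟨a, b, k, rfl⟩ | ⟨c, a, b, k, rfl⟩
    · rw [mulRel, mul_sub, map_sub, evalPoly_mul_X, evalMultiset_mul, Finset.mul_sum, map_sum,
        sub_eq_zero, ← Finset.Nat.sum_antidiagonal_eq_sum_range_succ (fun i j => k.choose i •
          evalMultiset hm ((a, i) ::ₘ (b, j + 1) ::ₘ Finsupp.toMultiset s))]
      refine Finset.sum_congr rfl fun p _ => ?_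
      rw [mul_smul_comm, map_nsmul, evalPoly_mul_X_mul_X]
    · rw [linRel, mul_sub, mul_add, mul_smul_comm, map_sub, map_add, map_smul, evalPoly_mul_X,
        evalPoly_mul_X, evalPoly_mul_X, evalMultiset_smul_add, sub_self]
  | zero => simp
  | add x y _ _ hx hy => rw [mul_add, map_add, hx, hy, add_zero]
  | smul r x hx hx' => rw [smul_eq_mul, ← mul_assoc]; exact hx' _

/-- A Novikov algebra embeds into a commutative differential algebra with `m a b = a b'`. -/
theorem IsNovikov.exists_embedding {K : Type v} {N : Type u} [CommRing K] [AddCommGroup N]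
    [Module K N] {m : N →ₗ[K] N →ₗ[K] N} (hm : IsNovikov m) :
    ∃ (C : Type (max u v)) (_ : CommRing C) (_ : Algebra K C) (d : Derivation K C C)
      (j : N →ₗ[K] C), Function.Injective j ∧ ∀ a b, j (m a b) = j a * d (j b) := by
  let I := relIdeal m
  let d₀ : (MvPolynomial (N × ℕ) K ⧸ I) →ₗ[K] (MvPolynomial (N × ℕ) K ⧸ I) :=
    Submodule.mapQ (I.restrictScalars K) (I.restrictScalars K) (polyDeriv K N).toLinearMap
      fun p hp => polyDeriv_mem_relIdeal hp
  have hd : ∀ p, d₀ (Ideal.Quotient.mk I p) = Ideal.Quotient.mk I (polyDeriv K N p) :=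
    fun p => rfl
  let d : Derivation K (MvPolynomial (N × ℕ) K ⧸ I) (MvPolynomial (N × ℕ) K ⧸ I) :=
    Derivation.mk' d₀ fun x y => by
      obtain ⟨x, rfl⟩ := Ideal.Quotient.mk_surjective x
      obtain ⟨y, rfl⟩ := Ideal.Quotient.mk_surjective y
      rw [← map_mul, hd, hd, hd, Derivation.leibniz]
      simp
  have hlin : ∀ (c : K) (a b : N), Ideal.Quotient.mk I (X (c • a + b, 0)) =
      c • Ideal.Quotient.mk I (X (a, 0)) + Ideal.Quotient.mk I (X (b, 0)) := by
    intro c a b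
    symm
    exact Ideal.Quotient.eq.2 (Ideal.subset_span (Or.inr ⟨c, a, b, 0, rfl⟩))
  have hzero : Ideal.Quotient.mk I (X (0, 0)) = 0 := by
    simpa using hlin 1 0 0
  let j : N →ₗ[K] (MvPolynomial (N × ℕ) K ⧸ I) :=
    { toFun := fun a => Ideal.Quotient.mk I (X (a, 0))
      map_add' := fun a b => by simpa using hlin 1 a b
      map_smul' := fun c a => by simpa [hzero] using hlin c a 0 }
  refine ⟨_, _, _, d, j, ?_, fun a b => ?_⟩
  · rw [injective_iff_map_eq_zero]
    intro a ha
    have := evalPoly_mul_mem_relIdeal hm 1 (Ideal.Quotient.eq_zero_iff_mem.1 ha)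
    rwa [one_mul, evalPoly_X] at this
  · change Ideal.Quotient.mk I _ = Ideal.Quotient.mk I _ * Ideal.Quotient.mk I (polyDeriv K N _)
    rw [← map_mul, polyDeriv_X]
    symm
    refine Ideal.Quotient.eq.2 (Ideal.subset_span (Or.inl ⟨a, b, 0, ?_⟩))
    simp [mulRel]

end Embedding

/-! ### Novikov bimodules -/

section Bimodule

variable {K A M : Type*} [Field K] [LeftPreLieRing A] [LeftPreLieAlgebra K A]
  [AddCommGroup M] [Module K M]

/-- The operators `L a` and `R a` are a bimodule structure on `M` of the kind that Novikov algebras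
have; in a commutative differential algebra these are `L a u = a u'` and `R a u = u a'`. -/
structure IsNovikovBimodule (L R : A →ₗ[K] Module.End K M) : Prop where
  right_comm : ∀ a b, R a * R b = R b * R a
  right_left : ∀ a b, R b * L a = L (a * b)
  left_right : ∀ a b, L a * R b - R b * L a = R (a * b) - R a * R b
  left_left : ∀ a b, L a * L b - L b * L a = L (a * b) - L (b * a)

/-- The product on `End M × End M × M` for which `a ↦ (L a, R a, 0)` is multiplicative for every
bimodule structure `L`, `R` on `M`, and which extends the actions on `M`. -/
def operatorMul (K M : Type*) [Field K] [AddCommGroup M] [Module K M] :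
    (Module.End K M × Module.End K M × M) →ₗ[K] (Module.End K M × Module.End K M × M) →ₗ[K]
      (Module.End K M × Module.End K M × M) :=
  LinearMap.mk₂ K
    (fun x y => (y.2.1 * x.1, x.1 * y.2.1 - y.2.1 * x.1 + x.2.1 * y.2.1,
      x.1 y.2.2 + y.2.1 x.2.2))
    (fun x x' y => by
      ext <;> simp [mul_add, add_mul] <;> abel)
    (fun c x y => by
      ext <;> simp [smul_sub, smul_add])
    (fun x y y' => by
      ext <;> simp [mul_add, add_mul] <;> abel)
    (fun c x y => by
      ext <;> simp [smul_sub, smul_add])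

theorem mul_mul_sub_mul_mul (a b c : A) :
    a * (b * c) - b * (a * c) = (a * b) * c - (b * a) * c := by
  have := LeftPreLieRing.assoc_symm' a b c
  simp only [associator] at this
  rw [sub_eq_sub_iff_add_eq_add] at this ⊢
  rw [add_comm, ← this, add_comm]

namespace IsNovikovBimodule

variable {L R : A →ₗ[K] Module.End K M}

/-- A Novikov bimodule `M` embeds into a Novikov algebra that acts on it through the operators
`L a` and `R a`: the algebra of the triples `(L a, R a, u)`. Passing from `a` to its operators is
needed because `A` itself need not be right-commutative. -/
theorem exists_novikov_range {M : Type u} [AddCommGroup M] [Module K M]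
    {L R : A →ₗ[K] Module.End K M} (h : IsNovikovBimodule L R) :
    ∃ (N : Type u) (_ : AddCommGroup N) (_ : Module K N) (m : N →ₗ[K] N →ₗ[K] N) (j : A →ₗ[K] N) (i : M →ₗ[K] N), IsNovikov m ∧ Function.Injective i ∧
      (∀ a b, j (a * b) = m (j a) (j b)) ∧ ∀ a u, i (L a u) = m (j a) (i u) := by
  let ψ : (A × M) →ₗ[K] (Module.End K M × Module.End K M × M) :=
    (L.prod (R.prod 0)).coprod (LinearMap.inr K _ _ ∘ₗ LinearMap.inr K _ _)
  have hψ : ∀ x, ψ x = (L x.1, R x.1, x.2) := fun x => by simp [ψ]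
  have hmul : ∀ x y, operatorMul K M (ψ x) (ψ y) =
      ψ (x.1 * y.1, L x.1 y.2 + R y.1 x.2) := by
    intro x y
    rw [hψ, hψ, hψ]
    simp only [operatorMul, LinearMap.mk₂_apply, h.right_left]
    rw [← h.right_left, h.left_right, sub_add_cancel]
  let m : LinearMap.range ψ →ₗ[K] LinearMap.range ψ →ₗ[K] LinearMap.range ψ :=
    LinearMap.mk₂ K (fun x y => ⟨operatorMul K M x y, by
        obtain ⟨_, x, rfl⟩ := x
        obtain ⟨_, y, rfl⟩ := y
        exact ⟨_, (hmul x y).symm⟩⟩)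
      (fun _ _ _ => by ext1; simp) (fun _ _ _ => by ext1; simp)
      (fun _ _ _ => by ext1; simp) (fun _ _ _ => by ext1; simp)
  have hm : ∀ x y, m (ψ.rangeRestrict x) (ψ.rangeRestrict y) =
      ψ.rangeRestrict (x.1 * y.1, L x.1 y.2 + R y.1 x.2) := by
    intro x y
    ext1
    exact hmul x y
  refine ⟨LinearMap.range ψ, inferInstance, inferInstance, m, ψ.rangeRestrict ∘ₗ LinearMap.inl K A M,
    ψ.rangeRestrict ∘ₗ LinearMap.inr K A M, ⟨fun x y z => ?_, fun x y z => ?_⟩, fun u v huv => ?_,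
    fun a b => ?_, fun a u => ?_⟩
  · obtain ⟨x, rfl⟩ := ψ.surjective_rangeRestrict x
    obtain ⟨y, rfl⟩ := ψ.surjective_rangeRestrict y
    obtain ⟨z, rfl⟩ := ψ.surjective_rangeRestrict z
    simp only [hm]
    rw [← map_sub, ← map_sub]
    congr 1
    obtain ⟨a, u⟩ := x
    obtain ⟨b, v⟩ := y
    obtain ⟨c, w⟩ := z
    have hl : ∀ a b u, L a (L b u) - L b (L a u) = L (a * b) u - L (b * a) u :=
      fun a b u => LinearMap.congr_fun (h.left_left a b) u
    have hlr : ∀ a b u, L a (R b u) - R b (L a u) = R (a * b) u - R a (R b u) :=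
      fun a b u => LinearMap.congr_fun (h.left_right a b) u
    have hc : ∀ a b u, R a (R b u) = R b (R a u) :=
      fun a b u => LinearMap.congr_fun (h.right_comm a b) u
    ext1
    · exact LeftPreLieRing.assoc_symm' a b c
    · simp only [Prod.snd_sub, map_add]
      have h1 := hl a b w
      have h2 := hlr a c v
      have h3 := hlr b c u
      rw [← sub_eq_zero] at h1 h2 h3 ⊢
      have key : ∀ p q r s : M, q = 0 → r = 0 → s = 0 → p = -q - r + s → p = 0 := by
        rintro p q r s rfl rfl rfl rfl; simp
      refine key _ _ _ _ h1 h2 h3 ?_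
      rw [hc c b, hc c a]
      abel
  · obtain ⟨x, rfl⟩ := ψ.surjective_rangeRestrict x
    obtain ⟨y, rfl⟩ := ψ.surjective_rangeRestrict y
    obtain ⟨z, rfl⟩ := ψ.surjective_rangeRestrict z
    simp only [hm]
    ext1
    change ψ _ = ψ _
    obtain ⟨a, u⟩ := x
    obtain ⟨b, v⟩ := y
    obtain ⟨c, w⟩ := z
    rw [hψ, hψ]
    have hR : ∀ a b c, R (a * b * c) = L a * (R b * R c) - R b * R c * L a
        + R a * (R b * R c) := by
      intro a b c
      have e : ∀ a b, R (a * b) = L a * R b - R b * L a + R a * R b := fun a b => by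
        rw [h.left_right]; abel
      rw [e, e, ← h.right_left, h.right_comm b c]
      have := h.right_comm b c
      simp only [sub_mul, add_mul, mul_assoc, this]
      simp only [← mul_assoc]
      abel
    have hL : ∀ a b u, R b (L a u) = L (a * b) u :=
      fun a b u => LinearMap.congr_fun (h.right_left a b) u
    refine Prod.ext ?_ (Prod.ext ?_ ?_)
    · change L (a * b * c) = L (a * c * b)
      rw [← h.right_left, ← h.right_left, ← h.right_left, ← h.right_left, ← mul_assoc,
        ← mul_assoc, h.right_comm]
    · change R (a * b * c) = R (a * c * b)
      rw [hR, hR, h.right_comm]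
    · change L (a * b) w + R c (L a v + R b u) = L (a * c) v + R b (L a w + R c u)
      rw [map_add, map_add, hL, hL, show R c (R b u) = R b (R c u) from
        LinearMap.congr_fun (h.right_comm c b) u]
      abel
  · have := congrArg Subtype.val huv
    change ψ (0, u) = ψ (0, v) at this
    rw [hψ, hψ] at this
    simpa using this
  · change ψ.rangeRestrict (a * b, 0) = m (ψ.rangeRestrict (a, 0)) (ψ.rangeRestrict (b, 0))
    simp only [hm, map_zero, add_zero]
  · change ψ.rangeRestrict (0, L a u) = m (ψ.rangeRestrict (a, 0)) (ψ.rangeRestrict (0, u))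
    simp only [hm, map_zero, add_zero, mul_zero]

open TensorProduct

/-- The space of the endomorphisms that commute with all right multiplications. -/
def rightCentralizer (R : A →ₗ[K] Module.End K M) : Submodule K (Module.End K M) where
  carrier := {T | ∀ x, R x * T = T * R x}
  add_mem' hS hT x := by rw [mul_add, add_mul, hS, hT]
  zero_mem' x := by rw [mul_zero, zero_mul]
  smul_mem' c T hT x := by rw [mul_smul_comm, smul_mul_assoc, hT]

theorem commutator_mem (h : IsNovikovBimodule L R) (a : A) {T : Module.End K M}
    (hT : T ∈ rightCentralizer R) : L a * T - T * L a ∈ rightCentralizer R := by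
  intro x
  replace hT : ∀ x, R x * T = T * R x := hT
  have e : L a * R x = R x * L a + (R (a * x) - R a * R x) := by
    rw [← h.left_right]; abel
  have e1 : L a * T * R x = R x * (L a * T) + (R (a * x) - R a * R x) * T := by
    rw [mul_assoc, ← hT, ← mul_assoc, e]; noncomm_ring
  have e2 : T * L a * R x = R x * (T * L a) + T * (R (a * x) - R a * R x) := by
    rw [mul_assoc, e, mul_add, ← mul_assoc, ← hT]; noncomm_ring
  have e3 : T * (R (a * x) - R a * R x) = (R (a * x) - R a * R x) * T := by
    rw [mul_sub, sub_mul, ← hT, ← mul_assoc, ← hT, mul_assoc, ← hT, mul_assoc]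
  rw [sub_mul, mul_sub, e1, e2, e3]
  abel

theorem right_mul_mem (h : IsNovikovBimodule L R) (a : A) {T : Module.End K M}
    (hT : T ∈ rightCentralizer R) : R a * T ∈ rightCentralizer R := by
  intro x
  rw [mul_assoc, ← hT x, ← mul_assoc, ← mul_assoc, h.right_comm]

/-- The operators `T ↦ [L a, T]` on `rightCentralizer R`. -/
def commutatorMap (h : IsNovikovBimodule L R) :
    A →ₗ[K] rightCentralizer R →ₗ[K] rightCentralizer R :=
  LinearMap.mk₂ K (fun a T => ⟨L a * T - T * L a, h.commutator_mem a T.2⟩)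
    (fun _ _ _ => by ext1; simp [add_mul, mul_add]; abel)
    (fun _ _ _ => by ext1; simp [smul_sub])
    (fun _ _ _ => by ext1; simp [add_mul, mul_add]; abel)
    (fun _ _ _ => by ext1; simp [smul_sub])

@[simp] theorem coe_commutatorMap (h : IsNovikovBimodule L R) (a : A) (T : rightCentralizer R) :
    (h.commutatorMap a T : Module.End K M) = L a * T - T * L a := rfl

/-- The operators `T ↦ R a * T` on `rightCentralizer R`. -/
def rightMulMap (h : IsNovikovBimodule L R) :
    A →ₗ[K] rightCentralizer R →ₗ[K] rightCentralizer R :=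
  LinearMap.mk₂ K (fun a T => ⟨R a * T, h.right_mul_mem a T.2⟩)
    (fun _ _ _ => by ext1; simp [add_mul])
    (fun _ _ _ => by ext1; simp)
    (fun _ _ _ => by ext1; simp [mul_add])
    (fun _ _ _ => by ext1; simp)

@[simp] theorem coe_rightMulMap (h : IsNovikovBimodule L R) (a : A) (T : rightCentralizer R) :
    (h.rightMulMap a T : Module.End K M) = R a * T := rfl

/-- The underlying space of the extension of the bimodule `M` by freely added elements `v` of `A`:
`T ⊗ v` stands for the product of `v` with the multiplication operator `T`. -/
abbrev ExtSpace (R : A →ₗ[K] Module.End K M) : Type _ := rightCentralizer R ⊗[K] A × M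

/-- `T ⊗ v ↦ T (r a v)`. -/
def applyMap (R : A →ₗ[K] Module.End K M) (r : A →ₗ[K] A →ₗ[K] M) (a : A) :
    rightCentralizer R ⊗[K] A →ₗ[K] M :=
  TensorProduct.lift (LinearMap.mk₂ K (fun T v => (T : Module.End K M) (r a v))
    (fun _ _ _ => by simp) (fun _ _ _ => by simp) (fun _ _ _ => by simp) (fun _ _ _ => by simp))

@[simp] theorem applyMap_tmul (R : A →ₗ[K] Module.End K M) (r : A →ₗ[K] A →ₗ[K] M) (a v : A)
    (T : rightCentralizer R) : applyMap R r a (T ⊗ₜ v) = (T : Module.End K M) (r a v) := rfl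

/-- The left action on `ExtSpace R` for which `a` sends `1 ⊗ v` to `r a v`. -/
def extLeft (h : IsNovikovBimodule L R) (r : A →ₗ[K] A →ₗ[K] M) :
    A →ₗ[K] Module.End K (ExtSpace R) where
  toFun a := ((h.commutatorMap a).rTensor A ∘ₗ LinearMap.fst K _ _).prod
    ((applyMap R r a).coprod (L a))
  map_add' a b := by
    ext <;> simp
  map_smul' c a := by
    ext <;> simp [smul_tmul']

/-- The right action on `ExtSpace R`. -/
def extRight (h : IsNovikovBimodule L R) : A →ₗ[K] Module.End K (ExtSpace R) where
  toFun a := ((h.rightMulMap a).rTensor A).prodMap (R a)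
  map_add' a b := by
    ext <;> simp
  map_smul' c a := by
    ext <;> simp [smul_tmul']

theorem extLeft_tmul (h : IsNovikovBimodule L R) (r : A →ₗ[K] A →ₗ[K] M) (a v : A)
    (T : rightCentralizer R) (u : M) : h.extLeft r a (T ⊗ₜ v, u) =
      (h.commutatorMap a T ⊗ₜ v, (T : Module.End K M) (r a v) + L a u) := rfl

theorem extRight_tmul (h : IsNovikovBimodule L R) (a v : A) (T : rightCentralizer R) (u : M) :
    h.extRight a (T ⊗ₜ v, u) = (h.rightMulMap a T ⊗ₜ v, R a u) := rfl

theorem extSpace_hom_ext {f g : Module.End K (ExtSpace R)}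
    (H : ∀ T v u, f (T ⊗ₜ v, u) = g (T ⊗ₜ v, u)) : f = g := by
  refine LinearMap.prod_ext (TensorProduct.ext' fun T v => H T v 0) ?_
  refine LinearMap.ext fun u => ?_
  simpa using H 0 0 u

/-- `ExtSpace R` is a Novikov bimodule. -/
theorem extension (h : IsNovikovBimodule L R) (r : A →ₗ[K] A →ₗ[K] M)
    (hR : ∀ a x v, r (a * x) v = R x (r a v))
    (hL : ∀ a b v, L a (r b v) - L b (r a v) = r (a * b) v - r (b * a) v) :
    IsNovikovBimodule (M := ExtSpace R) (h.extLeft r) h.extRight where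
  right_comm a b := by
    refine extSpace_hom_ext fun T v u => ?_
    simp only [Module.End.mul_apply, extRight_tmul]
    refine Prod.ext (congrArg (· ⊗ₜ[K] v) ?_) ?_
    · ext1
      simp only [coe_rightMulMap]
      rw [← mul_assoc, h.right_comm, mul_assoc]
    · exact LinearMap.congr_fun (h.right_comm a b) u
  right_left a b := by
    refine extSpace_hom_ext fun T v u => ?_
    simp only [Module.End.mul_apply, extRight_tmul, extLeft_tmul]
    have hT : ∀ x, R x * (T : Module.End K M) = T * R x := T.2
    refine Prod.ext (congrArg (· ⊗ₜ[K] v) ?_) ?_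
    · ext1
      simp only [coe_rightMulMap, coe_commutatorMap]
      rw [← h.right_left, mul_sub, ← mul_assoc (R b) _ (L a), hT, mul_assoc, mul_assoc]
    · change R b ((T : Module.End K M) (r a v) + L a u) =
        (T : Module.End K M) (r (a * b) v) + L (a * b) u
      rw [map_add, hR]
      congr 1
      · exact LinearMap.congr_fun (hT b) _
      · exact LinearMap.congr_fun (h.right_left a b) u
  left_right a b := by
    refine extSpace_hom_ext fun T v u => ?_
    change h.extLeft r a (h.extRight b _) - h.extRight b (h.extLeft r a _) =
      h.extRight (a * b) _ - h.extRight a (h.extRight b _)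
    simp only [extRight_tmul, extLeft_tmul, Prod.mk_sub_mk, ← sub_tmul]
    refine Prod.ext (congrArg (· ⊗ₜ[K] v) ?_) ?_
    · ext1
      simp only [coe_rightMulMap, coe_commutatorMap, AddSubgroupClass.coe_sub]
      have e : L a * R b = R b * L a + (R (a * b) - R a * R b) := by
        rw [← h.left_right]; abel
      rw [← mul_assoc, e]
      noncomm_ring
    · have e := LinearMap.congr_fun (h.left_right a b) u
      simp only [Module.End.mul_apply, LinearMap.sub_apply] at e
      rw [coe_rightMulMap, map_add, Module.End.mul_apply, add_sub_add_left_eq_sub, e]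
  left_left a b := by
    refine extSpace_hom_ext fun T v u => ?_
    change h.extLeft r a (h.extLeft r b _) - h.extLeft r b (h.extLeft r a _) =
      h.extLeft r (a * b) _ - h.extLeft r (b * a) _
    simp only [extLeft_tmul, Prod.mk_sub_mk, ← sub_tmul]
    refine Prod.ext (congrArg (· ⊗ₜ[K] v) ?_) ?_
    · ext1
      simp only [coe_commutatorMap, AddSubgroupClass.coe_sub]
      have e : L (a * b) - L (b * a) = L a * L b - L b * L a := (h.left_left a b).symm
      have e' : L (a * b) * (T : Module.End K M) - T * L (a * b)
          - (L (b * a) * T - T * L (b * a)) =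
          (L (a * b) - L (b * a)) * T - T * (L (a * b) - L (b * a)) := by noncomm_ring
      rw [e', e]
      noncomm_ring
    · have e := LinearMap.congr_fun (h.left_left a b) u
      simp only [Module.End.mul_apply, LinearMap.sub_apply] at e
      simp only [coe_commutatorMap, map_add, Module.End.mul_apply, LinearMap.sub_apply]
      have e' : (T : Module.End K M) (r (a * b) v) - (T : Module.End K M) (r (b * a) v) =
          (T : Module.End K M) (L a (r b v)) - (T : Module.End K M) (L b (r a v)) := by
        rw [← map_sub, ← map_sub, hL]
      rw [add_sub_add_comm ((T : Module.End K M) (r (a * b) v)), e', ← e]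
      abel

/-- Let `s` embed `M` into `A` as a subspace that contains the products `r a v` of `A`. Then `A`
maps to a Novikov algebra in two ways, `j` and `e`, which turn the product of `A` into the actions
of the first copy on itself and on the second; only `e` has to be injective, and only on `M`. -/
theorem exists_novikov {A M : Type u} [LeftPreLieRing A] [LeftPreLieAlgebra K A]
    [AddCommGroup M] [Module K M] {L R : A →ₗ[K] Module.End K M} (h : IsNovikovBimodule L R)
    (r : A →ₗ[K] A →ₗ[K] M) (s : M →ₗ[K] A) (hs : Function.Injective s)
    (hsr : ∀ a v, s (r a v) = a * v) (hrs : ∀ a u, r a (s u) = L a u)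
    (hR : ∀ a x v, r (a * x) v = R x (r a v)) :
    ∃ (N : Type u) (_ : AddCommGroup N) (_ : Module K N) (m : N →ₗ[K] N →ₗ[K] N)
      (j e : A →ₗ[K] N), IsNovikov m ∧ (∀ a b, j (a * b) = m (j a) (j b)) ∧
      (∀ a b, e (a * b) = m (j a) (e b)) ∧ ∀ u, e (s u) = 0 → u = 0 := by
  have hL : ∀ a b v, L a (r b v) - L b (r a v) = r (a * b) v - r (b * a) v := by
    intro a b v
    apply hs
    rw [← hrs, ← hrs, map_sub, map_sub, hsr, hsr, hsr, hsr, hsr, hsr, mul_mul_sub_mul_mul]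
  obtain ⟨N, _, _, m, j, i, hm, hi, hj, hij⟩ := (h.extension r hR hL).exists_novikov_range
  obtain ⟨π, hπ⟩ := s.exists_leftInverse_of_injective (LinearMap.ker_eq_bot.2 hs)
  replace hπ : ∀ u, π (s u) = u := fun u => LinearMap.congr_fun hπ u
  let one : rightCentralizer R := ⟨1, fun x => by rw [mul_one, one_mul]⟩
  let f : A →ₗ[K] ExtSpace R :=
    (TensorProduct.mk K (rightCentralizer R) A one ∘ₗ (LinearMap.id - s ∘ₗ π)).prod π
  have hf : ∀ v, f v = (one ⊗ₜ (v - s (π v)), π v) := fun v => rfl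
  have hf' : ∀ u, f (s u) = (0, u) := fun u => by
    rw [hf, hπ, sub_self, tmul_zero]
  refine ⟨N, inferInstance, inferInstance, m, j, i ∘ₗ f, hm, hj, fun a b => ?_, fun u h0 => ?_⟩
  · rw [LinearMap.comp_apply, LinearMap.comp_apply, ← hij]
    congr 1
    rw [hf b, h.extLeft_tmul, ← hsr, hf']
    have h0 : h.commutatorMap a one = 0 := by
      ext1
      simp [one]
    rw [h0, zero_tmul]
    congr 1
    change _ = r a (b - s (π b)) + L a (π b)
    rw [← hrs, ← map_add, sub_add_cancel]
  · have := hi (h0.trans (map_zero i).symm)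
    rw [hf' u] at this
    simpa using this

end IsNovikovBimodule

end Bimodule

/-! ### The bimodule of products of a nice SLS-algebra -/

section SLS

open TensorProduct

variable {K : Type v} {A : Type u} [Field K] [LeftPreLieRing A] [LeftPreLieAlgebra K A]

theorem mulSpan_hom_ext {W : Type*} [AddCommMonoid W] [Module K W] {f g : mulSpan K A →ₗ[K] W}
    (h : ∀ a b, f ⟨a * b, mul_mem_mulSpan K a b⟩ = g ⟨a * b, mul_mem_mulSpan K a b⟩) : f = g := by
  refine LinearMap.ext fun ⟨u, hu⟩ => ?_
  induction hu using Submodule.span_induction with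
  | mem x hx => obtain ⟨⟨a, b⟩, rfl⟩ := hx; exact h a b
  | zero => exact (map_zero f).trans (map_zero g).symm
  | add x y hx hy h1 h2 =>
    have := congrArg₂ (· + ·) h1 h2
    simp only [← map_add] at this
    exact this
  | smul c x hx h1 =>
    have := congrArg (c • ·) h1
    simp only [← map_smul] at this
    exact this

/-- The product of `A`, with values in the span of the products. -/
def mulToSpan (K : Type v) (A : Type u) [Field K] [LeftPreLieRing A] [LeftPreLieAlgebra K A] :
    A →ₗ[K] A →ₗ[K] mulSpan K A :=
  LinearMap.mk₂ K (fun a b => ⟨a * b, mul_mem_mulSpan K a b⟩)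
    (fun _ _ _ => by ext1; simp [add_mul]) (fun _ _ _ => by ext1; simp [smul_mul_assoc])
    (fun _ _ _ => by ext1; simp [mul_add]) (fun _ _ _ => by ext1; simp [mul_smul_comm])

@[simp] theorem coe_mulToSpan (a b : A) : (mulToSpan K A a b : A) = a * b := rfl

/-- The commutation rule `[L a, R b] = R (a ∘ b) - R a R b`, evaluated at a product `x ∘ y`. -/
theorem IsSLS.left_right (h : IsSLS A) (a b x y : A) :
    a * ((x * b) * y) - (a * b) * (x * y) = (x * (a * b)) * y - ((x * b) * a) * y := by
  have h1 := LeftPreLieRing.assoc_symm' (a * b) x y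
  have h2 := h.associator_mul x a b y
  have h3 := LeftPreLieRing.assoc_symm' a x b
  have h4 := congrArg (· * y) h3
  have h5 := h.right_comm_mul a b x y
  have h6 := h.right_comm_mul x b a y
  simp only [associator, sub_mul] at h1 h2 h4
  rw [h5] at h1
  rw [h6]
  rw [← sub_eq_zero] at h1 h2 h4 ⊢
  have key : ∀ p q r s : A, q = 0 → r = 0 → s = 0 → p = q + r - s → p = 0 := by
    rintro p q r s rfl rfl rfl rfl; simp
  refine key _ _ _ _ h1 h2 h4 ?_
  abel

/-- The products of a nice SLS-algebra form a Novikov bimodule, with the maps of niceness as right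
multiplications. -/
theorem IsNiceSLS.exists_bimodule (h : IsNiceSLS K A) :
    ∃ R : A →ₗ[K] Module.End K (mulSpan K A),
      IsNovikovBimodule ((LinearMap.lcomp K _ (mulSpan K A).subtype) ∘ₗ mulToSpan K A) R ∧
      ∀ x a b, R x (mulToSpan K A a b) = mulToSpan K A (a * x) b := by
  choose μ hμ using h.nice
  have hmem : ∀ x u, μ x u ∈ mulSpan K A := by
    rintro x ⟨u, hu⟩
    induction hu using Submodule.span_induction with
    | mem y hy => obtain ⟨⟨a, b⟩, rfl⟩ := hy; rw [hμ]; exact mul_mem_mulSpan K _ _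
    | zero => rw [show (⟨0, _⟩ : mulSpan K A) = 0 from rfl, map_zero]; exact zero_mem _
    | add y z hy hz h1 h2 =>
      have := add_mem h1 h2
      rwa [← map_add] at this
    | smul c y hy h1 =>
      have := Submodule.smul_mem _ c h1
      rwa [← map_smul] at this
  have hR' : ∀ x a b, (μ x).codRestrict _ (hmem x) (mulToSpan K A a b) =
      mulToSpan K A (a * x) b := fun x a b => Subtype.ext (hμ x a b)
  let R : A →ₗ[K] Module.End K (mulSpan K A) :=
    { toFun := fun x => (μ x).codRestrict _ (hmem x)
      map_add' := fun x y => mulSpan_hom_ext fun a b => by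
        change _ = (μ x).codRestrict _ (hmem x) (mulToSpan K A a b) +
          (μ y).codRestrict _ (hmem y) (mulToSpan K A a b)
        rw [hR', hR', ← LinearMap.add_apply, ← map_add, ← mul_add]
        exact hR' _ a b
      map_smul' := fun c x => mulSpan_hom_ext fun a b => by
        change _ = c • (μ x).codRestrict _ (hmem x) (mulToSpan K A a b)
        rw [hR', ← LinearMap.smul_apply, ← map_smul, ← mul_smul_comm]
        exact hR' _ a b }
  have hR : ∀ x a b, R x (mulToSpan K A a b) = mulToSpan K A (a * x) b := hR'
  refine ⟨R, ⟨fun a b => ?_, fun a b => ?_, fun a b => ?_, fun a b => ?_⟩, hR⟩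
  · refine mulSpan_hom_ext fun x y => ?_
    change R a (R b (mulToSpan K A x y)) = R b (R a (mulToSpan K A x y))
    rw [hR, hR, hR, hR]
    exact Subtype.ext (h.right_comm_mul x b a y)
  · refine LinearMap.ext fun u => ?_
    exact hR b a u
  · refine mulSpan_hom_ext fun x y => ?_
    change mulToSpan K A a (R b (mulToSpan K A x y)) - R b (mulToSpan K A a (x * y)) =
      R (a * b) (mulToSpan K A x y) - R a (R b (mulToSpan K A x y))
    rw [hR, hR, hR, hR]
    exact Subtype.ext (h.left_right a b x y)
  · refine LinearMap.ext fun u => ?_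
    exact Subtype.ext (mul_mul_sub_mul_mul a b u)

/-- A nice SLS-algebra `A` has two linear maps `j`, `e` to a commutative differential algebra that
satisfy `j (a ∘ b) = j a (j b)'` and `e (a ∘ b) = j a (e b)'`, with `e` injective on `A ∘ A`. -/
theorem IsNiceSLS.exists_differential (h : IsNiceSLS K A) :
    ∃ (C : Type (max u v)) (_ : CommRing C) (_ : Algebra K C) (d : Derivation K C C)
      (j e : A →ₗ[K] C), (∀ a b, j (a * b) = j a * d (j b)) ∧
      (∀ a b, e (a * b) = j a * d (e b)) ∧ ∀ u ∈ mulSpan K A, e u = 0 → u = 0 := by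
  obtain ⟨R, hLR, hR⟩ := h.exists_bimodule
  obtain ⟨N, _, _, m, j, e, hm, hj, he, he0⟩ := hLR.exists_novikov (mulToSpan K A)
    (mulSpan K A).subtype Subtype.val_injective (fun a v => rfl) (fun a u => rfl)
    (fun a x v => (hR x a v).symm)
  obtain ⟨C, _, _, d, k, hk, hkm⟩ := hm.exists_embedding
  refine ⟨C, inferInstance, inferInstance, d, k ∘ₗ j, k ∘ₗ e, fun a b => ?_, fun a b => ?_,
    fun u hu h0 => ?_⟩
  · simp only [LinearMap.comp_apply, hj, hkm]
  · simp only [LinearMap.comp_apply, he, hkm]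
  · exact congrArg Subtype.val (he0 ⟨u, hu⟩ (hk (h0.trans (map_zero k).symm)))

end SLS

/-! ### Differential Perm-algebras -/

section Perm

variable {K : Type v} {A : Type u} [Field K] [LeftPreLieRing A] [LeftPreLieAlgebra K A]

/-- The space `C × C × Q` with the product `(x, y, q) (x', y', q') = (y x', y y', 0)`. -/
def PermExtension (C Q : Type*) : Type _ := C × C × Q

namespace PermExtension

variable {C Q : Type*} [CommRing C] [AddCommGroup Q]

instance : AddCommGroup (PermExtension C Q) := inferInstanceAs (AddCommGroup (C × C × Q))

instance [Algebra K C] [Module K Q] : Module K (PermExtension C Q) :=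
  inferInstanceAs (Module K (C × C × Q))

instance : NonUnitalRing (PermExtension C Q) where
  mul x y := (x.2.1 * y.1, x.2.1 * y.2.1, 0)
  left_distrib _ _ _ :=
    Prod.ext (mul_add _ _ _) (Prod.ext (mul_add _ _ _) (add_zero _).symm)
  right_distrib _ _ _ :=
    Prod.ext (add_mul _ _ _) (Prod.ext (add_mul _ _ _) (add_zero _).symm)
  zero_mul _ := Prod.ext (zero_mul _) (Prod.ext (zero_mul _) rfl)
  mul_zero _ := Prod.ext (mul_zero _) (Prod.ext (mul_zero _) rfl)
  mul_assoc _ _ _ := Prod.ext (mul_assoc _ _ _) (Prod.ext (mul_assoc _ _ _) rfl)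

theorem isPerm : IsPerm (PermExtension C Q) := fun a b c => by
  refine Prod.ext ?_ (Prod.ext ?_ rfl)
  · exact congrArg (· * c.1) (mul_comm a.2.1 b.2.1)
  · exact congrArg (· * c.2.1) (mul_comm a.2.1 b.2.1)

instance [Algebra K C] [Module K Q] :
    IsScalarTower K (PermExtension C Q) (PermExtension C Q) where
  smul_assoc c x y :=
    Prod.ext (smul_mul_assoc c x.2.1 y.1) (Prod.ext (smul_mul_assoc c x.2.1 y.2.1)
      (smul_zero c).symm)

instance [Algebra K C] [Module K Q] :
    SMulCommClass K (PermExtension C Q) (PermExtension C Q) where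
  smul_comm c x y :=
    Prod.ext (mul_smul_comm c x.2.1 y.1).symm (Prod.ext (mul_smul_comm c x.2.1 y.2.1).symm
      (smul_zero c))

/-- The derivation of `PermExtension C Q` given by a derivation of `C`. -/
def deriv [Algebra K C] [Module K Q] (d : Derivation K C C) :
    PermExtension C Q →ₗ[K] PermExtension C Q :=
  (d : C →ₗ[K] C).prodMap ((d : C →ₗ[K] C).prodMap (0 : Q →ₗ[K] Q))

theorem isLeibniz_deriv [Algebra K C] [Module K Q] (d : Derivation K C C) :
    IsLeibniz (deriv d : PermExtension C Q →ₗ[K] PermExtension C Q) := fun a b => by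
  have h : ∀ x y : C, d (x * y) = d x * y + x * d y := fun x y => by
    rw [Derivation.leibniz, smul_eq_mul, smul_eq_mul]; ring
  exact Prod.ext (h _ _) (Prod.ext (h _ _) (add_zero _).symm)

end PermExtension

/-- The embedding is `a ↦ (e a, j a, [a])`; the class of `a` modulo `A ∘ A` makes it injective. -/
theorem IsNiceSLS.embeds (h : IsNiceSLS K A) : EmbedsInDifferentialPerm.{u, v, w} K A := by
  obtain ⟨C, _, _, d, j, e, hj, he, he0⟩ := h.exists_differential
  let q : A →ₗ[K] ULift.{w} (A ⧸ mulSpan K A) :=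
    ULift.moduleEquiv.symm.toLinearMap ∘ₗ (mulSpan K A).mkQ
  have hq : ∀ u, q u = 0 → u ∈ mulSpan K A := fun u hu => by
    have := congrArg ULift.down hu
    exact (Submodule.Quotient.mk_eq_zero _).1 this
  have hq' : ∀ a b, q (a * b) = 0 := fun a b => by
    refine ULift.ext _ _ ?_
    exact (Submodule.Quotient.mk_eq_zero _).2 (mul_mem_mulSpan K a b)
  refine ⟨PermExtension C (ULift.{w} (A ⧸ mulSpan K A)), inferInstance, inferInstance,
    inferInstance, inferInstance, PermExtension.deriv d, e.prod (j.prod q), PermExtension.isPerm,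
    PermExtension.isLeibniz_deriv d, ?_, fun a b => ?_⟩
  · refine (injective_iff_map_eq_zero (e.prod (j.prod q))).2 fun u hu => ?_
    exact he0 u (hq u (congrArg (fun x => x.2.2) hu)) (congrArg Prod.fst hu)
  · exact Prod.ext (he a b) (Prod.ext (hj a b) (hq' a b))

theorem EmbedsInDifferentialPerm.isNiceSLS (h : EmbedsInDifferentialPerm.{u, v, w} K A) :
    IsNiceSLS K A := by
  obtain ⟨P, _, _, _, _, d, ι, hP, hd, hι, hmul⟩ := h
  have hP3 : ∀ a b c : P, a * (b * c) = b * (a * c) := fun a b c => by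
    rw [← mul_assoc, ← mul_assoc, hP]
  have hassoc : ∀ a b c, ι (associator a b c) = -(ι a * (ι b * d (d (ι c)))) := by
    intro a b c
    rw [associator, map_sub, hmul, hmul, hmul, hmul, hd, mul_add, mul_assoc]
    abel
  refine ⟨⟨fun x y z t => hι ?_, fun x y z t => hι ?_⟩, fun x => ?_⟩
  · simp only [hmul, mul_assoc]
    rw [hP3 (d (ι y))]
  · rw [hassoc, hassoc, hmul, hmul, mul_assoc, mul_assoc, hP3]
  · -- `μₓ` is multiplication by `x'` in `P`, which maps `A ∘ A` into `A`
    let f : mulSpan K A →ₗ[K] P :=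
      LinearMap.mulLeft K (d (ι x)) ∘ₗ ι ∘ₗ (mulSpan K A).subtype
    have hf : ∀ a b, f ⟨a * b, mul_mem_mulSpan K a b⟩ = ι ((a * x) * b) := by
      intro a b
      change d (ι x) * ι (a * b) = _
      rw [hmul, hmul, hmul, hP3, mul_assoc]
    obtain ⟨π, hπ⟩ := ι.exists_leftInverse_of_injective (LinearMap.ker_eq_bot.2 hι)
    refine ⟨π ∘ₗ f, fun a b => ?_⟩
    rw [LinearMap.comp_apply, hf]
    exact LinearMap.congr_fun hπ _

theorem IsNiceSLS.satisfiesNiceQuasiIdentities (h : IsNiceSLS K A) :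
    SatisfiesNiceQuasiIdentities A := by
  intro n a b hab x
  obtain ⟨μ, hμ⟩ := h.nice x
  have h0 : ∑ i, (⟨a i * b i, mul_mem_mulSpan K (a i) (b i)⟩ : mulSpan K A) = 0 := by
    ext1
    simpa using hab
  have := congrArg μ h0
  rw [map_sum, map_zero] at this
  simpa only [hμ] using this

open TensorProduct in
/-- The quasi-identities say that `a ⊗ b ↦ (a ∘ x) ∘ b` vanishes on the kernel of the product map
`A ⊗ A → A ∘ A`. -/
theorem IsSLS.isNiceSLS (h : IsSLS A) (hq : SatisfiesNiceQuasiIdentities A) : IsNiceSLS K A := by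
  refine ⟨h, fun x => ?_⟩
  let p : A ⊗[K] A →ₗ[K] mulSpan K A := TensorProduct.lift (mulToSpan K A)
  let g : A ⊗[K] A →ₗ[K] A := TensorProduct.lift
    ((LinearMap.mul K A) ∘ₗ (LinearMap.mul K A).flip x)
  have hpg : ∀ t, p t = 0 → g t = 0 := by
    intro t ht
    obtain ⟨S, rfl⟩ := TensorProduct.exists_finset t
    rw [map_sum] at ht ⊢
    have hS : ∀ f : A × A → A, ∑ i, f (S.equivFin.symm i) = ∑ i ∈ S, f i := fun f => by
      rw [Equiv.sum_comp S.equivFin.symm (fun i => f i), Finset.sum_coe_sort S f]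
    refine (hS fun i => (i.1 * x) * i.2).symm.trans (hq _ _ _ ((hS fun i => i.1 * i.2).trans ?_) x)
    simpa [p] using congrArg Subtype.val ht
  have hp : Function.Surjective p := by
    rintro ⟨u, hu⟩
    induction hu using Submodule.span_induction with
    | mem y hy => obtain ⟨⟨a, b⟩, rfl⟩ := hy; exact ⟨a ⊗ₜ b, rfl⟩
    | zero => exact ⟨0, map_zero p⟩
    | add y z hy hz h1 h2 =>
      obtain ⟨s, hs⟩ := h1
      obtain ⟨t, ht⟩ := h2
      exact ⟨s + t, by rw [map_add, hs, ht]; rfl⟩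
    | smul c y hy h1 =>
      obtain ⟨s, hs⟩ := h1
      exact ⟨c • s, by rw [map_smul, hs]; rfl⟩
  obtain ⟨σ, hσ⟩ := p.exists_rightInverse_of_surjective (LinearMap.range_eq_top.2 hp)
  refine ⟨g ∘ₗ σ, fun a b => ?_⟩
  have h0 : p (σ ⟨a * b, mul_mem_mulSpan K a b⟩ - a ⊗ₜ b) = 0 := by
    rw [map_sub, sub_eq_zero]
    exact LinearMap.congr_fun hσ _
  have := hpg _ h0
  rw [map_sub, sub_eq_zero] at this
  exact this

end Perm

theorem mainTheorem1 (K : Type v) (A : Type u) [Field K] [LeftPreLieRing A]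
    [LeftPreLieAlgebra K A] :
    (EmbedsInDifferentialPerm.{u, v, w} K A ↔ IsNiceSLS K A) ∧
    (EmbedsInDifferentialPerm.{u, v, w} K A ↔
      IsSLS A ∧ SatisfiesNiceQuasiIdentities A) :=
  ⟨⟨fun h => h.isNiceSLS, fun h => h.embeds⟩,
    ⟨fun h => ⟨h.isNiceSLS.toIsSLS, h.isNiceSLS.satisfiesNiceQuasiIdentities⟩,
      fun h => (h.1.isNiceSLS h.2).embeds⟩⟩
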